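/- Write $h(t)=(t,\cos t,\sin t)$ for the circular helix in $\mathbb R^3$. A convex $3$-polytope is a three-dimensional convex hull of finitely many points. A facet of a closed convex set in $\mathbb R^3$ is a two-dimensional face cut out by a supporting plane. A family of sets in $\mathbb R^3$ is called neighborly if every two different members have a two-dimensional intersection. Two sets are congruent if an isometry of $\mathbb R^3$ maps one onto the other. (1) For every positive integer $n$ there is a neighborly family of $n$ congruent convex $3$-polytopes; moreover, the family can be chosen so that the intersection of every two different members is a facet of both. (2) For a positive integer $n$ and $t\in\mathbb Z$ let $h_n(t)=h(2\pi t/n)$, and let $V_n(t)=\{x\in\mathbb R^3 : |x-h_n(t)|\le |x-h_n(s)| \text{ for all } s\in\mathbb Z\}$ be the Voronoi region of $h_n(t)$ with respect to the infinite point set $\{h_n(s): s\in\mathbb Z\}$. Let $H_n(t)=\{(x,y,z): y\cos(2\pi t/n)+z\sin(2\pi t/n)\le n\}$, and let $$g_n(x,y,z)=\Bigl(x+\tfrac{2\pi}{n},\; y\cos\tfrac{2\pi}{n}-z\sin\tfrac{2\pi}{n},\; y\sin\tfrac{2\pi}{n}+z\cos\tfrac{2\pi}{n}\Bigr).$$ The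 screw motion $g_n$ is an isometry, and for every $t\in\mathbb Z$ it maps $h_n(t)$ to $h_n(t+1)$, $V_n(t)$ onto $V_n(t+1)$ and $H_n(t)$ onto $H_n(t+1)$. For every $a\in\mathbb Z$, any two different regions among the $n+1$ consecutive regions $V_n(a),V_n(a+1),\dots,V_n(a+n)$ intersect in a facet of both. (3) If $n\ge 3$, then each clipped region $P_n(t)=V_n(t)\cap H_n(t)$ is a convex $3$-polytope, $g_n$ maps $P_n(t)$ onto $P_n(t+1)$ for every $t\in\mathbb Z$, so that all the $P_n(t)$ are congruent, and for every $a\in\mathbb Z$ the $n+1$ polytopes $P_n(a),P_n(a+1),\dots,P_n(a+n)$ form a neighborly family. (4) (Bitangent Lemma) For every $0<t<\pi$ there is exactly one sphere that passes through $h(t)$ and $h(-t)$ and is tangent to the helix at both points, and this sphere meets the helix only at $h(t)$ and $h(-t)$. -/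

import Mathlib

open scoped Real

/-- Euclidean three-space; the coordinates `0, 1, 2` are `x, y, z`. -/
abbrev E3 : Type := EuclideanSpace ℝ (Fin 3)

/-! ### Convex geometry -/

/-- The dimension of a set in three-space: the dimension of its affine hull
(and `0` for the empty set). -/
noncomputable def setDim (A : Set E3) : ℕ :=
  Module.finrank ℝ (vectorSpan ℝ A)

/-- A convex 3-polytope: a three-dimensional convex hull of finitely many points. -/
def IsConvexPolytope3 (A : Set E3) : Prop :=
  (∃ F : Finset E3, A = convexHull ℝ (F : Set E3)) ∧ setDim A = 3

/-- `F` is a facet of the convex set `A`: a face of `A`, cut out by a supporting hyperplane,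
whose dimension is two. -/
def IsFacet (F A : Set E3) : Prop :=
  IsExposed ℝ A F ∧ setDim F = 2

/-- Two sets are congruent if an isometry of the whole space maps one onto the other. -/
def AreCongruent (A B : Set E3) : Prop :=
  ∃ g : E3 ≃ᵢ E3, g '' A = B

/-- A family is neighborly if any two different members have a two-dimensional intersection. -/
def IsNeighborly {ι : Type*} (P : ι → Set E3) : Prop :=
  Pairwise fun i j => setDim (P i ∩ P j) = 2

/-- Any two different members of the family meet exactly in a facet of both. -/
def MeetInCommonFacets {ι : Type*} (P : ι → Set E3) : Prop :=
  Pairwise fun i j => IsFacet (P i ∩ P j) (P i) ∧ IsFacet (P i ∩ P j) (P j)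

/-- The Voronoi region of the site `p` with respect to the set of sites `S`. -/
def voronoiRegion (S : Set E3) (p : E3) : Set E3 :=
  {x | ∀ q ∈ S, dist x p ≤ dist x q}

/-! ### The helix -/

/-- The circular helix `h(t) = (t, cos t, sin t)`. -/
noncomputable def helix (t : ℝ) : E3 :=
  !₂[t, Real.cos t, Real.sin t]

/-- The tangent line of the helix at `h(t)`. -/
noncomputable def helixTangentLine (t : ℝ) : AffineSubspace ℝ E3 :=
  AffineSubspace.mk' (helix t) (Submodule.span ℝ {deriv helix t})

/-- The sphere passes through `h(t)` and `h(-t)` and is tangent to the helix at both points. -/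
def IsBitangentSphere (S : EuclideanGeometry.Sphere E3) (t : ℝ) : Prop :=
  S.IsTangentAt (helix t) (helixTangentLine t) ∧
    S.IsTangentAt (helix (-t)) (helixTangentLine (-t))

/-- The angular step `θ = 2π/n`. -/
noncomputable def stepAngle (n : ℕ) : ℝ :=
  2 * π / n

/-- The evenly spaced points `h_n(t) = h(2πt/n)`, for `t` an integer. -/
noncomputable def helixPoint (n : ℕ) (t : ℤ) : E3 :=
  helix (2 * π * t / n)

/-- The Voronoi region `V_n(t)` of `h_n(t)` with respect to all the points `h_n(s)`, `s ∈ ℤ`. -/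
noncomputable def helixRegion (n : ℕ) (t : ℤ) : Set E3 :=
  voronoiRegion (Set.range (helixPoint n)) (helixPoint n t)

/-- The clipping halfspace `y cos(2πt/n) + z sin(2πt/n) ≤ n`. -/
noncomputable def clipHalfspace (n : ℕ) (t : ℤ) : Set E3 :=
  {p | p 1 * Real.cos (2 * π * t / n) + p 2 * Real.sin (2 * π * t / n) ≤ n}

/-- The clipped Voronoi region. -/
noncomputable def clippedRegion (n : ℕ) (t : ℤ) : Set E3 :=
  helixRegion n t ∩ clipHalfspace n t

/-- The screw motion: translation by `2π/n` along the `x`-axis combined with the rotation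
by `2π/n` about the `x`-axis. -/
noncomputable def screw (n : ℕ) (p : E3) : E3 :=
  !₂[p 0 + stepAngle n,
    p 1 * Real.cos (stepAngle n) - p 2 * Real.sin (stepAngle n),
    p 1 * Real.sin (stepAngle n) + p 2 * Real.cos (stepAngle n)]

/-!
On the principal normal of the helix at `h(α)`, the point at distance `1 + R` from `h(α)` has
squared distance `s ^ 2 + 2 * R * cos s + R ^ 2 + 1` from `h(α + s)`. If `R * sin t = t` with
`0 < t < π`, then `|s| = t` are the global minima in `s`: the sphere through `h(α ± t)` centred
there is bitangent and contains no other point of the helix. Hence two sites `h_n(i)`, `h_n(j)` with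
`0 < |i - j| < n` lie on a sphere having all the other sites strictly outside, so near its centre
their Voronoi regions meet in a whole disc of the bisecting plane.

When `|i - j| = n`, so that `t = π`, no such `R` exists. But then the parameters `s` of the sites
are spaced by `2 * π / n`, and none lies strictly between `π - 2 * π / n` and `π`. For
`R = m := max n 3` the value at `π` is strictly less than the values on the compact interval
`|s| ≤ π - 2 * π / m`; this persists for `R` slightly less than `m`, and for `|s| > π` it holds for
every `R ≥ 0`. In both cases the centre of the sphere is at distance less than `m` from the axis, so
for `n ≥ 3` clipping at distance `n` leaves the intersections two-dimensional.

For (1), all the regions are clipped by one and the same prism, invariant under the screw motion,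
so that common faces remain facets.
-/

open Filter Set Topology

/-! ### Polyhedral sets -/

section Polyhedral

variable {E : Type*} [AddCommGroup E] [Module ℝ E] [TopologicalSpace E]

/-- A polyhedral set: the intersection of finitely many closed halfspaces `{x | f x ≤ b}`, each
encoded by the pair `(f, b)`. -/
def IsPolyhedral (A : Set E) : Prop :=
  ∃ F : Set (StrongDual ℝ E × ℝ), F.Finite ∧ A = {x | ∀ f ∈ F, f.1 x ≤ f.2}

theorem isPolyhedral_univ : IsPolyhedral (univ : Set E) :=
  ⟨∅, finite_empty, by simp⟩

theorem isPolyhedral_halfspace (f : StrongDual ℝ E) (b : ℝ) : IsPolyhedral {x | f x ≤ b} :=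
  ⟨{(f, b)}, finite_singleton _, by simp⟩

namespace IsPolyhedral

variable {A B : Set E}

theorem inter (hA : IsPolyhedral A) (hB : IsPolyhedral B) : IsPolyhedral (A ∩ B) := by
  obtain ⟨F, hF, rfl⟩ := hA
  obtain ⟨G, hG, rfl⟩ := hB
  refine ⟨F ∪ G, hF.union hG, ?_⟩
  ext x
  simp only [mem_inter_iff, mem_ofPred_eq, mem_union, or_imp, forall_and]

theorem biInter {ι : Type*} {T : Set ι} (hT : T.Finite) {A : ι → Set E}
    (hA : ∀ i ∈ T, IsPolyhedral (A i)) : IsPolyhedral (⋂ i ∈ T, A i) := by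
  induction T, hT using Finite.induction_on with
  | empty => simpa using isPolyhedral_univ
  | insert _ _ ih =>
    rw [biInter_insert]
    exact (hA _ (mem_insert _ _)).inter (ih fun i hi => hA i (mem_insert_of_mem _ hi))

theorem convex (hA : IsPolyhedral A) : Convex ℝ A := by
  obtain ⟨F, -, rfl⟩ := hA
  simp only [ofPred_forall]
  exact convex_iInter₂ fun f _ => convex_halfSpace_le f.1.isLinear f.2

theorem isClosed (hA : IsPolyhedral A) : IsClosed A := by
  obtain ⟨F, -, rfl⟩ := hA
  simp only [ofPred_forall]
  refine isClosed_iInter fun f => isClosed_iInter fun _ => ?_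
  exact isClosed_le f.1.continuous continuous_const

end IsPolyhedral

theorem eventually_add_smul_sub_mem_of_active_eq {F : Set (StrongDual ℝ E × ℝ)} (hF : F.Finite)
    {x y : E} (hx : ∀ f ∈ F, f.1 x ≤ f.2) (hy : ∀ f ∈ F, f.1 x = f.2 → f.1 y = f.2) :
    ∀ᶠ ε : ℝ in 𝓝 0, ∀ f ∈ F, f.1 (x + ε • (y - x)) ≤ f.2 := by
  simp only [map_add, map_smul, map_sub, smul_eq_mul]
  rw [eventually_all_finite hF]
  intro f hf
  rcases (hx f hf).eq_or_lt with hactive | hslack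
  · simp [hy f hf hactive, hactive]
  · have hcont : ContinuousAt (fun ε : ℝ => f.1 x + ε * (f.1 y - f.1 x)) 0 := by fun_prop
    have hlt : ∀ᶠ ε : ℝ in 𝓝 0, f.1 x + ε * (f.1 y - f.1 x) < f.2 :=
      hcont.eventually_lt continuousAt_const (by simpa using hslack)
    exact hlt.mono fun _ => le_of_lt

theorem eq_of_mem_extremePoints_of_active_eq {F : Set (StrongDual ℝ E × ℝ)} (hF : F.Finite)
    {x y : E} (hx : x ∈ {x | ∀ f ∈ F, f.1 x ≤ f.2}.extremePoints ℝ)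
    (hy : ∀ f ∈ F, f.1 x = f.2 → f.1 y = f.2) : x = y := by
  rw [mem_extremePoints_iff_left] at hx
  have hmem := eventually_add_smul_sub_mem_of_active_eq hF hx.1 hy
  have hmem_neg : ∀ᶠ ε : ℝ in 𝓝 0, ∀ f ∈ F, f.1 (x + (-ε) • (y - x)) ≤ f.2 :=
    (continuous_neg.tendsto' (0 : ℝ) 0 neg_zero).eventually hmem
  obtain ⟨ε, ⟨hadd, hsub⟩, hε⟩ :=
    (((hmem.and hmem_neg).filter_mono nhdsWithin_le_nhds).and
      (self_mem_nhdsWithin : {0}ᶜ ∈ 𝓝[≠] (0 : ℝ))).exists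
  have hmid : x ∈ openSegment ℝ (x + ε • (y - x)) (x + (-ε) • (y - x)) :=
    ⟨1 / 2, 1 / 2, by norm_num, by norm_num, by norm_num, by module⟩
  have hstep : ε • (y - x) = 0 := add_eq_left.1 (hx.2 _ hadd _ hsub hmid)
  exact (sub_eq_zero.1 ((smul_eq_zero.1 hstep).resolve_left hε)).symm

theorem IsPolyhedral.finite_extremePoints {A : Set E} (hA : IsPolyhedral A) :
    (A.extremePoints ℝ).Finite := by
  obtain ⟨F, hF, rfl⟩ := hA
  refine Finite.of_injOn (f := fun x => {f ∈ F | f.1 x = f.2}) (t := {G | G ⊆ F})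
    (fun x _ => sep_subset _ _) (fun x hx y _ hxy => ?_) hF.finite_subsets
  exact eq_of_mem_extremePoints_of_active_eq hF hx fun f hf hfx => (hxy.le ⟨hf, hfx⟩).2

theorem IsPolyhedral.exists_eq_convexHull [T2Space E] [IsTopologicalAddGroup E]
    [ContinuousSMul ℝ E] [LocallyConvexSpace ℝ E] {A : Set E} (hA : IsPolyhedral A)
    (hcomp : IsCompact A) : ∃ V : Finset E, A = convexHull ℝ (V : Set E) := by
  refine ⟨hA.finite_extremePoints.toFinset, ?_⟩
  have hclosed := (hA.finite_extremePoints.isCompact_convexHull ℝ).isClosed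
  rw [Finite.coe_toFinset, ← hclosed.closure_eq, closure_convexHull_extremePoints hcomp hA.convex]

end Polyhedral

/-! ### Dimension and facets -/

theorem vectorSpan_inter_of_mem_nhds {V : Type*} [AddCommGroup V] [Module ℝ V]
    [TopologicalSpace V] [ContinuousAdd V] [ContinuousSMul ℝ V] {L : AffineSubspace ℝ V} {c : V}
    {C : Set V} (hc : c ∈ L) (hC : C ∈ 𝓝 c) : vectorSpan ℝ (L ∩ C : Set V) = L.direction := by
  refine le_antisymm (vectorSpan_mono ℝ inter_subset_left) fun v hv => ?_
  have hcont : ContinuousAt (fun ε : ℝ => ε • v +ᵥ c) 0 := by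
    simp only [vadd_eq_add]
    fun_prop
  have hC' : ∀ᶠ ε : ℝ in 𝓝[≠] 0, ε • v +ᵥ c ∈ C :=
    (hcont.eventually_mem (by simpa using hC)).filter_mono nhdsWithin_le_nhds
  obtain ⟨ε, hεC, hε⟩ := (hC'.and self_mem_nhdsWithin).exists
  have hεL : ε • v +ᵥ c ∈ L :=
    AffineSubspace.vadd_mem_of_mem_direction (L.direction.smul_mem ε hv) hc
  have hdiff := vsub_mem_vectorSpan ℝ (s := (L ∩ C : Set V)) ⟨hεL, hεC⟩ ⟨hc, mem_of_mem_nhds hC⟩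
  rw [vadd_vsub] at hdiff
  exact (Submodule.smul_mem_iff _ hε).1 hdiff

theorem setDim_eq_three_of_mem_nhds {A : Set E3} {c : E3} (hA : A ∈ 𝓝 c) : setDim A = 3 := by
  have hspan := vectorSpan_inter_of_mem_nhds (AffineSubspace.mem_top ℝ E3 c) hA
  rw [AffineSubspace.top_coe, univ_inter, AffineSubspace.direction_top] at hspan
  rw [setDim, hspan, finrank_top, finrank_euclideanSpace_fin]

theorem setDim_perpBisector_inter {p q c : E3} (hpq : p ≠ q) (hc : dist c p = dist c q)
    {C : Set E3} (hC : C ∈ 𝓝 c) :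
    setDim (AffineSubspace.perpBisector p q ∩ C : Set E3) = 2 := by
  have : Fact (Module.finrank ℝ E3 = 2 + 1) := ⟨by simp⟩
  rw [setDim, vectorSpan_inter_of_mem_nhds (AffineSubspace.mem_perpBisector_iff_dist_eq.2 hc) hC,
    AffineSubspace.direction_perpBisector, vsub_eq_sub]
  exact Submodule.finrank_orthogonal_span_singleton (sub_ne_zero.2 hpq.symm)

theorem isExposed_setOf_eq {E : Type*} [AddCommGroup E] [Module ℝ E] [TopologicalSpace E]
    {A : Set E} {f : StrongDual ℝ E} {b : ℝ} (hA : ∀ x ∈ A, f x ≤ b) :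
    IsExposed ℝ A {x ∈ A | f x = b} := by
  rintro ⟨w, hwA, hw⟩
  refine ⟨f, ?_⟩
  ext x
  refine and_congr_right fun hx => ⟨fun hfx y hy => hfx ▸ hA y hy, fun hmax => ?_⟩
  exact (hA x hx).antisymm (hw ▸ hmax w hwA)

section Bisector

variable {E : Type*} [NormedAddCommGroup E] [InnerProductSpace ℝ E]

theorem dist_sq_sub_dist_sq_eq (x p q : E) :
    dist x q ^ 2 - dist x p ^ 2 =
      ‖q‖ ^ 2 - ‖p‖ ^ 2 - 2 * innerSL ℝ (q - p) x := by
  rw [dist_eq_norm, dist_eq_norm, norm_sub_sq_real, norm_sub_sq_real, innerSL_apply_apply,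
    inner_sub_left, real_inner_comm x q, real_inner_comm x p]
  ring

theorem dist_le_dist_iff_innerSL_le (x p q : E) :
    dist x p ≤ dist x q ↔ innerSL ℝ (q - p) x ≤ (‖q‖ ^ 2 - ‖p‖ ^ 2) / 2 := by
  have h := dist_sq_sub_dist_sq_eq x p q
  rw [← sq_le_sq₀ dist_nonneg dist_nonneg]
  constructor <;> intro <;> linarith

theorem dist_eq_dist_iff_innerSL_eq (x p q : E) :
    dist x p = dist x q ↔ innerSL ℝ (q - p) x = (‖q‖ ^ 2 - ‖p‖ ^ 2) / 2 := by
  have h := dist_sq_sub_dist_sq_eq x p q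
  rw [← sq_eq_sq₀ dist_nonneg dist_nonneg]
  constructor <;> intro <;> linarith

theorem isPolyhedral_setOf_dist_le_dist (p q : E) : IsPolyhedral {x | dist x p ≤ dist x q} := by
  simp only [dist_le_dist_iff_innerSL_le]
  exact isPolyhedral_halfspace _ _

theorem isExposed_inter_perpBisector {A : Set E} {p q : E}
    (hA : ∀ x ∈ A, dist x p ≤ dist x q) :
    IsExposed ℝ A (A ∩ AffineSubspace.perpBisector p q) := by
  have hface : A ∩ AffineSubspace.perpBisector p q =
      {x ∈ A | innerSL ℝ (q - p) x = (‖q‖ ^ 2 - ‖p‖ ^ 2) / 2} := by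
    ext x
    exact and_congr_right fun _ =>
      AffineSubspace.mem_perpBisector_iff_dist_eq.trans (dist_eq_dist_iff_innerSL_eq x p q)
  rw [hface]
  exact isExposed_setOf_eq fun x hx => (dist_le_dist_iff_innerSL_le x p q).1 (hA x hx)

end Bisector

/-! ### Voronoi regions of locally finite sets of sites -/

/-- A set is locally finite if every ball contains only finitely many of its points. -/
def IsLocallyFiniteSet {X : Type*} [PseudoMetricSpace X] (S : Set X) : Prop :=
  ∀ (c : X) (r : ℝ), (S ∩ Metric.closedBall c r).Finite

theorem IsLocallyFiniteSet.mono {X : Type*} [PseudoMetricSpace X] {S T : Set X}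
    (hT : IsLocallyFiniteSet T) (hST : S ⊆ T) : IsLocallyFiniteSet S := fun c r =>
  (hT c r).subset (inter_subset_inter_left _ hST)

theorem subset_ball_of_isPreconnected_of_disjoint_sphere {X : Type*} [PseudoMetricSpace X]
    {K : Set X} {p : X} {r : ℝ} (hK : IsPreconnected K) (hp : p ∈ K) (hr : 0 ≤ r)
    (hdisj : Disjoint K (Metric.sphere p r)) : K ⊆ Metric.ball p r := by
  intro x hx
  by_contra hxr
  have hrange : r ∈ Icc (dist p p) (dist x p) := ⟨by rwa [dist_self], not_lt.1 hxr⟩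
  obtain ⟨y, hy, hyr⟩ :=
    hK.intermediate_value hp hx (continuous_id.dist continuous_const).continuousOn hrange
  exact disjoint_left.1 hdisj hy hyr

section Voronoi

variable {S T C : Set E3} {p q c x : E3}

theorem voronoiRegion_anti (hST : S ⊆ T) (p : E3) : voronoiRegion T p ⊆ voronoiRegion S p :=
  fun _ hx q hq => hx q (hST hq)

theorem self_mem_voronoiRegion (S : Set E3) (p : E3) : p ∈ voronoiRegion S p := fun q _ => by
  rw [dist_self]
  exact dist_nonneg

theorem isPolyhedral_voronoiRegion (hS : S.Finite) (p : E3) :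
    IsPolyhedral (voronoiRegion S p) := by
  have hinter : voronoiRegion S p = ⋂ q ∈ S, {x | dist x p ≤ dist x q} := by
    ext x
    simp only [voronoiRegion, mem_ofPred_eq, mem_iInter]
  rw [hinter]
  exact IsPolyhedral.biInter hS fun q _ => isPolyhedral_setOf_dist_le_dist p q

theorem mem_voronoiRegion_of_dist_le {r : ℝ}
    (hx : x ∈ voronoiRegion (S ∩ Metric.closedBall p (2 * r)) p) (hr : dist x p ≤ r) :
    x ∈ voronoiRegion S p := by
  intro q hq
  by_cases hqp : dist q p ≤ 2 * r
  · exact hx q ⟨hq, hqp⟩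
  · linarith [dist_triangle_left q p x]

theorem isPolyhedral_voronoiRegion_inter (hS : IsLocallyFiniteSet S) (hC : IsPolyhedral C)
    (hp : p ∈ C) (hbdd : Bornology.IsBounded (voronoiRegion S p ∩ C)) :
    IsPolyhedral (voronoiRegion S p ∩ C) := by
  obtain ⟨M, hM⟩ := hbdd.subset_closedBall p
  have hM_nonneg : 0 ≤ M := Metric.nonempty_closedBall.1 ⟨p, hM ⟨self_mem_voronoiRegion S p, hp⟩⟩
  set near := S ∩ Metric.closedBall p (2 * (M + 1))
  have hnear : IsPolyhedral (voronoiRegion near p ∩ C) :=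
    (isPolyhedral_voronoiRegion (hS p _) p).inter hC
  -- Inside the ball the far sites impose no condition, so the convex set cut out by the near sites
  -- would have to cross the sphere of radius `M + 1` at a point of `voronoiRegion S p` to leave it.
  have hball : voronoiRegion near p ∩ C ⊆ Metric.ball p (M + 1) := by
    refine subset_ball_of_isPreconnected_of_disjoint_sphere hnear.convex.isPreconnected
      ⟨self_mem_voronoiRegion near p, hp⟩ (by positivity) (disjoint_left.2 fun x hx hxM => ?_)
    have hxS : x ∈ voronoiRegion S p := mem_voronoiRegion_of_dist_le hx.1 (le_of_eq hxM)
    have hle : dist x p ≤ M := hM ⟨hxS, hx.2⟩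
    rw [Metric.mem_sphere.1 hxM] at hle
    linarith
  have heq : voronoiRegion S p ∩ C = voronoiRegion near p ∩ C :=
    (inter_subset_inter_left C (voronoiRegion_anti inter_subset_left p)).antisymm fun x hx =>
      ⟨mem_voronoiRegion_of_dist_le hx.1 (Metric.mem_ball.1 (hball hx)).le, hx.2⟩
  rw [heq]
  exact hnear

theorem voronoiRegion_mem_nhds_of_forall_dist_lt (hS : IsLocallyFiniteSet S)
    (hc : ∀ q ∈ S, dist c p < dist c q) : voronoiRegion S p ∈ 𝓝 c := by
  have hnear : ∀ᶠ x in 𝓝 c, ∀ q ∈ S ∩ Metric.closedBall p (2 * (dist c p + 1)),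
      dist x p ≤ dist x q := by
    rw [eventually_all_finite (hS p _)]
    intro q hq
    have hlt : ∀ᶠ x in 𝓝 c, dist x p < dist x q :=
      ContinuousAt.eventually_lt (by fun_prop) (by fun_prop) (hc q hq.1)
    exact hlt.mono fun _ => le_of_lt
  filter_upwards [hnear, Metric.ball_mem_nhds c one_pos] with x hx hxc
  refine mem_voronoiRegion_of_dist_le hx ?_
  linarith [dist_triangle x c p, Metric.mem_ball.1 hxc]

theorem voronoiRegion_diff_singleton (S : Set E3) (p : E3) :
    voronoiRegion (S \ {p}) p = voronoiRegion S p := by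
  refine (voronoiRegion_anti sdiff_subset p).antisymm' fun x hx q hq => ?_
  rcases eq_or_ne q p with rfl | hqp
  · exact le_rfl
  · exact hx q ⟨hq, hqp⟩

theorem voronoiRegion_mem_nhds_self (hS : IsLocallyFiniteSet S) (p : E3) :
    voronoiRegion S p ∈ 𝓝 p := by
  rw [← voronoiRegion_diff_singleton]
  refine voronoiRegion_mem_nhds_of_forall_dist_lt (hS.mono sdiff_subset) fun q hq => ?_
  rw [dist_self, dist_pos]
  exact Ne.symm hq.2

theorem isConvexPolytope3_voronoiRegion_inter (hS : IsLocallyFiniteSet S) (hC : IsPolyhedral C)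
    (hp : C ∈ 𝓝 p) (hbdd : Bornology.IsBounded (voronoiRegion S p ∩ C)) :
    IsConvexPolytope3 (voronoiRegion S p ∩ C) := by
  have hpoly := isPolyhedral_voronoiRegion_inter hS hC (mem_of_mem_nhds hp) hbdd
  exact ⟨hpoly.exists_eq_convexHull (Metric.isCompact_of_isClosed_isBounded hpoly.isClosed hbdd),
    setDim_eq_three_of_mem_nhds (inter_mem (voronoiRegion_mem_nhds_self hS p) hp)⟩

theorem mem_voronoiRegion_iff_mem_perpBisector (hp : p ∈ S) (hq : q ∈ S)
    (hx : x ∈ voronoiRegion S p) :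
    x ∈ voronoiRegion S q ↔ x ∈ AffineSubspace.perpBisector p q := by
  rw [AffineSubspace.mem_perpBisector_iff_dist_eq]
  exact ⟨fun hxq => (hx q hq).antisymm (hxq p hp), fun heq r hr => heq ▸ hx r hr⟩

theorem voronoiRegion_inter_voronoiRegion (hp : p ∈ S) (hq : q ∈ S) :
    voronoiRegion S p ∩ voronoiRegion S q =
      (AffineSubspace.perpBisector p q : Set E3) ∩ voronoiRegion (S \ {p, q}) p := by
  ext x
  constructor
  · rintro ⟨hxp, hxq⟩
    exact ⟨(mem_voronoiRegion_iff_mem_perpBisector hp hq hxp).1 hxq,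
      voronoiRegion_anti sdiff_subset p hxp⟩
  · rintro ⟨hbis, hx⟩
    have hxp : x ∈ voronoiRegion S p := by
      intro r hr
      by_cases hrpq : r ∈ ({p, q} : Set E3)
      · rcases hrpq with rfl | rfl
        exacts [le_rfl, (AffineSubspace.mem_perpBisector_iff_dist_eq.1 hbis).le]
      · exact hx r ⟨hr, hrpq⟩
    exact ⟨hxp, (mem_voronoiRegion_iff_mem_perpBisector hp hq hxp).2 hbis⟩

theorem image_voronoiRegion (g : E3 ≃ᵢ E3) (S : Set E3) (p : E3) :
    g '' voronoiRegion S p = voronoiRegion (g '' S) (g p) := by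
  ext x
  rw [← g.apply_symm_apply x, g.injective.mem_set_image]
  simp only [voronoiRegion, mem_ofPred_eq, forall_mem_image, g.dist_eq]

/-- `c` is the centre of a sphere through the sites `p` and `q` that has all the other sites of `S`
strictly outside. -/
def IsDelaunayCenter (S : Set E3) (p q c : E3) : Prop :=
  dist c p = dist c q ∧ ∀ r ∈ S \ {p, q}, dist c p < dist c r

namespace IsDelaunayCenter

theorem symm (h : IsDelaunayCenter S p q c) : IsDelaunayCenter S q p c :=
  ⟨h.1.symm, fun r hr => h.1 ▸ h.2 r (pair_comm p q ▸ hr)⟩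

theorem setDim_inter (h : IsDelaunayCenter S p q c) (hS : IsLocallyFiniteSet S) (hp : p ∈ S)
    (hq : q ∈ S) (hpq : p ≠ q) (hC : C ∈ 𝓝 c) :
    setDim (voronoiRegion S p ∩ C ∩ (voronoiRegion S q ∩ C)) = 2 := by
  rw [← inter_inter_distrib_right, voronoiRegion_inter_voronoiRegion hp hq, inter_assoc]
  exact setDim_perpBisector_inter hpq h.1
    (inter_mem (voronoiRegion_mem_nhds_of_forall_dist_lt (hS.mono sdiff_subset) h.2) hC)

theorem isFacet_inter (h : IsDelaunayCenter S p q c) (hS : IsLocallyFiniteSet S) (hp : p ∈ S)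
    (hq : q ∈ S) (hpq : p ≠ q) (hC : C ∈ 𝓝 c) :
    IsFacet (voronoiRegion S p ∩ C ∩ (voronoiRegion S q ∩ C)) (voronoiRegion S p ∩ C) := by
  refine ⟨?_, h.setDim_inter hS hp hq hpq hC⟩
  have hface : voronoiRegion S p ∩ C ∩ (voronoiRegion S q ∩ C) =
      voronoiRegion S p ∩ C ∩ AffineSubspace.perpBisector p q := by
    ext x
    refine and_congr_right fun hx => ?_
    rw [SetLike.mem_coe, ← mem_voronoiRegion_iff_mem_perpBisector hp hq hx.1]
    exact and_iff_left hx.2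
  rw [hface]
  exact isExposed_inter_perpBisector fun x hx => hx.1 q hq

end IsDelaunayCenter

end Voronoi

/-! ### Screw motions and the sites on the helix -/

@[simp] theorem helix_apply_zero (t : ℝ) : helix t 0 = t := rfl

@[simp] theorem helix_apply_one (t : ℝ) : helix t 1 = Real.cos t := rfl

@[simp] theorem helix_apply_two (t : ℝ) : helix t 2 = Real.sin t := rfl

theorem dist_sq_eq_sum_coord_sq (x y : E3) :
    dist x y ^ 2 = (x 0 - y 0) ^ 2 + (x 1 - y 1) ^ 2 + (x 2 - y 2) ^ 2 := by
  simp only [EuclideanSpace.dist_sq_eq, Fin.sum_univ_three, Real.dist_eq, sq_abs]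

theorem eq_of_coord_eq {x y : E3} (h0 : x 0 = y 0) (h1 : x 1 = y 1) (h2 : x 2 = y 2) : x = y := by
  ext i
  fin_cases i <;> assumption

/-- The screw motion about the `x`-axis with angle and translation length `φ`; it shifts the
parameter of the helix by `φ`. -/
noncomputable def screwMotion (φ : ℝ) : E3 ≃ᵢ E3 :=
  IsometryEquiv.mk'
    (fun p => !₂[p 0 + φ, p 1 * Real.cos φ - p 2 * Real.sin φ,
      p 1 * Real.sin φ + p 2 * Real.cos φ])
    (fun p => !₂[p 0 - φ, p 1 * Real.cos φ + p 2 * Real.sin φ,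
      p 2 * Real.cos φ - p 1 * Real.sin φ])
    (fun p => by
      apply eq_of_coord_eq <;> simp only [Matrix.cons_val]
      · ring
      · linear_combination p 1 * Real.sin_sq_add_cos_sq φ
      · linear_combination p 2 * Real.sin_sq_add_cos_sq φ)
    (Isometry.of_dist_eq fun x y => by
      rw [← sq_eq_sq₀ dist_nonneg dist_nonneg, dist_sq_eq_sum_coord_sq, dist_sq_eq_sum_coord_sq]
      simp only [Matrix.cons_val]
      linear_combination ((x 1 - y 1) ^ 2 + (x 2 - y 2) ^ 2) * Real.sin_sq_add_cos_sq φ)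

@[simp] theorem screwMotion_apply_zero (φ : ℝ) (p : E3) : screwMotion φ p 0 = p 0 + φ := rfl

@[simp] theorem screwMotion_apply_one (φ : ℝ) (p : E3) :
    screwMotion φ p 1 = p 1 * Real.cos φ - p 2 * Real.sin φ := rfl

@[simp] theorem screwMotion_apply_two (φ : ℝ) (p : E3) :
    screwMotion φ p 2 = p 1 * Real.sin φ + p 2 * Real.cos φ := rfl

theorem coe_screwMotion_stepAngle (n : ℕ) : ⇑(screwMotion (stepAngle n)) = screw n := rfl

theorem screwMotion_helix (φ s : ℝ) : screwMotion φ (helix s) = helix (s + φ) := by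
  apply eq_of_coord_eq <;>
    simp only [screwMotion_apply_zero, screwMotion_apply_one, screwMotion_apply_two,
      helix_apply_zero, helix_apply_one, helix_apply_two, Real.cos_add, Real.sin_add]
  ring

theorem two_pi_mul_add_div (n : ℕ) (t k : ℤ) :
    2 * π * (t + k : ℤ) / n = 2 * π * t / n + k * stepAngle n := by
  rw [stepAngle]
  push_cast
  ring

theorem screwMotion_helixPoint (n : ℕ) (t k : ℤ) :
    screwMotion (k * stepAngle n) (helixPoint n t) = helixPoint n (t + k) := by
  rw [helixPoint, helixPoint, screwMotion_helix, two_pi_mul_add_div]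

theorem image_screwMotion_range_helixPoint (n : ℕ) (k : ℤ) :
    screwMotion (k * stepAngle n) '' range (helixPoint n) = range (helixPoint n) := by
  rw [← range_comp, ← (Equiv.addRight k).surjective.range_comp (helixPoint n)]
  exact congrArg range (funext fun t => screwMotion_helixPoint n t k)

theorem image_screwMotion_helixRegion (n : ℕ) (t k : ℤ) :
    screwMotion (k * stepAngle n) '' helixRegion n t = helixRegion n (t + k) := by
  rw [helixRegion, image_voronoiRegion, image_screwMotion_range_helixPoint,
    screwMotion_helixPoint, helixRegion]

theorem image_screwMotion_clipHalfspace (n : ℕ) (t k : ℤ) :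
    screwMotion (k * stepAngle n) '' clipHalfspace n t = clipHalfspace n (t + k) := by
  ext x
  obtain ⟨y, rfl⟩ := (screwMotion (k * stepAngle n)).surjective x
  rw [(screwMotion _).injective.mem_set_image, clipHalfspace, clipHalfspace, mem_ofPred_eq,
    mem_ofPred_eq, two_pi_mul_add_div, screwMotion_apply_one, screwMotion_apply_two]
  generalize 2 * π * t / n = a, k * stepAngle n = φ
  have hinv : (y 1 * Real.cos φ - y 2 * Real.sin φ) * Real.cos (a + φ) +
      (y 1 * Real.sin φ + y 2 * Real.cos φ) * Real.sin (a + φ) =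
      y 1 * Real.cos a + y 2 * Real.sin a := by
    rw [Real.cos_add, Real.sin_add]
    linear_combination (y 1 * Real.cos a + y 2 * Real.sin a) * Real.sin_sq_add_cos_sq φ
  rw [hinv]

theorem image_screwMotion_clippedRegion (n : ℕ) (t k : ℤ) :
    screwMotion (k * stepAngle n) '' clippedRegion n t = clippedRegion n (t + k) := by
  rw [clippedRegion, image_inter (screwMotion _).injective, image_screwMotion_helixRegion,
    image_screwMotion_clipHalfspace, clippedRegion]

theorem helixPoint_injective {n : ℕ} (hn : 1 ≤ n) : Function.Injective (helixPoint n) := by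
  intro i j h
  have hcoord : 2 * π * i / n = 2 * π * j / n := congrArg (fun p : E3 => p 0) h
  have hn0 : (n : ℝ) ≠ 0 := by positivity
  rwa [div_left_inj' hn0, mul_right_inj' Real.two_pi_pos.ne', Int.cast_inj] at hcoord

theorem isLocallyFiniteSet_range_helixPoint {n : ℕ} (hn : 1 ≤ n) :
    IsLocallyFiniteSet (range (helixPoint n)) := by
  intro c r
  have hangle : 0 < 2 * π / n := by positivity
  refine ((finite_Icc ⌈(c 0 - r) / (2 * π / n)⌉ ⌊(c 0 + r) / (2 * π / n)⌋).image
    (helixPoint n)).subset ?_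
  rintro _ ⟨⟨k, rfl⟩, hk⟩
  have hcoord : |k * (2 * π / n) - c 0| ≤ r := by
    have h := (PiLp.dist_apply_le (helixPoint n k) c 0).trans hk
    rwa [Real.dist_eq, helixPoint, helix_apply_zero, mul_div_right_comm, mul_comm] at h
  obtain ⟨hlower, hupper⟩ := abs_le.1 hcoord
  refine ⟨k, ⟨Int.ceil_le.2 ?_, Int.le_floor.2 ?_⟩, rfl⟩
  · rw [div_le_iff₀ hangle]
    linarith
  · rw [le_div_iff₀ hangle]
    linarith

/-! ### Clipping -/

theorem isPolyhedral_clipHalfspace (n : ℕ) (t : ℤ) : IsPolyhedral (clipHalfspace n t) := by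
  have hdual := isPolyhedral_halfspace (Real.cos (2 * π * t / n) • EuclideanSpace.proj (𝕜 := ℝ)
    (1 : Fin 3) + Real.sin (2 * π * t / n) • EuclideanSpace.proj (𝕜 := ℝ) (2 : Fin 3)) n
  simpa [clipHalfspace, mul_comm] using hdual

theorem cylinder_subset_clipHalfspace (n : ℕ) (t : ℤ) :
    {x : E3 | x 1 ^ 2 + x 2 ^ 2 < n ^ 2} ⊆ clipHalfspace n t := by
  intro x hx
  rw [mem_ofPred_eq] at hx
  rw [clipHalfspace, mem_ofPred_eq]
  generalize 2 * π * t / n = a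
  refine (abs_le_of_sq_le_sq' ?_ n.cast_nonneg).2
  nlinarith [sq_nonneg (x 1 * Real.sin a - x 2 * Real.cos a), Real.sin_sq_add_cos_sq a, hx]

theorem cylinder_mem_nhds {r : ℝ} {c : E3} (hc : c 1 ^ 2 + c 2 ^ 2 < r) :
    {x : E3 | x 1 ^ 2 + x 2 ^ 2 < r} ∈ 𝓝 c := by
  have hopen : IsOpen {x : E3 | x 1 ^ 2 + x 2 ^ 2 < r} := isOpen_lt (by fun_prop) continuous_const
  exact hopen.mem_nhds hc

theorem periodic_clipHalfspace {n : ℕ} (hn : 1 ≤ n) :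
    Function.Periodic (clipHalfspace n) (n : ℤ) := by
  intro t
  have hn0 : (n : ℝ) ≠ 0 := by positivity
  have hangle : 2 * π * (t + n : ℤ) / n = 2 * π * t / n + 2 * π := by
    push_cast
    field_simp
  rw [clipHalfspace, hangle, Real.cos_add_two_pi, Real.sin_add_two_pi, clipHalfspace]

/-- The intersection of all the clipping halfspaces: an infinite prism over the regular `n`-gon
with inradius `n`. -/
noncomputable def clipPrism (n : ℕ) : Set E3 :=
  ⋂ t, clipHalfspace n t

theorem isPolyhedral_clipPrism {n : ℕ} (hn : 1 ≤ n) : IsPolyhedral (clipPrism n) := by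
  have hfinite : (range (clipHalfspace n)).Finite := by
    rw [← (periodic_clipHalfspace hn).image_Ioc (by lia) 0]
    exact (finite_Ioc _ _).image _
  rw [clipPrism, ← sInter_range, sInter_eq_biInter]
  refine IsPolyhedral.biInter hfinite ?_
  rintro _ ⟨t, rfl⟩
  exact isPolyhedral_clipHalfspace n t

theorem image_screwMotion_clipPrism (n : ℕ) (k : ℤ) :
    screwMotion (k * stepAngle n) '' clipPrism n = clipPrism n := by
  rw [clipPrism, image_iInter (screwMotion _).bijective]
  simp only [image_screwMotion_clipHalfspace]
  exact (Equiv.addRight k).surjective.iInter_comp (clipHalfspace n)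

theorem cylinder_subset_clipPrism (n : ℕ) :
    {x : E3 | x 1 ^ 2 + x 2 ^ 2 < n ^ 2} ⊆ clipPrism n :=
  subset_iInter (cylinder_subset_clipHalfspace n)

/-! ### Trigonometric inequalities -/

theorem mul_sin_lt_mul_sin {s t : ℝ} (hs : 0 < s) (hst : s < t) (ht : t ≤ π) :
    s * Real.sin t < t * Real.sin s := by
  have ht0 : 0 < t := hs.trans hst
  have hsecant := strictConcaveOn_sin_Icc.secant_strict_mono ⟨le_rfl, Real.pi_pos.le⟩
    ⟨hs.le, hst.le.trans ht⟩ ⟨ht0.le, ht⟩ hs.ne' ht0.ne' hst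
  rw [Real.sin_zero, sub_zero, sub_zero, sub_zero, sub_zero, div_lt_div_iff₀ ht0 hs] at hsecant
  linarith

theorem mul_cos_lt_sin {t : ℝ} (h0 : 0 < t) (h : t < π) : t * Real.cos t < Real.sin t := by
  rcases lt_or_ge t (π / 2) with hacute | hobtuse
  · have hcos : 0 < Real.cos t := Real.cos_pos_of_mem_Ioo ⟨by linarith, hacute⟩
    have htan := Real.lt_tan h0 hacute
    rwa [Real.tan_eq_sin_div_cos, lt_div_iff₀ hcos] at htan
  · have hcos := Real.cos_nonpos_of_pi_div_two_le_of_le hobtuse (by linarith)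
    exact (mul_nonpos_of_nonneg_of_nonpos h0.le hcos).trans_lt (Real.sin_pos_of_pos_of_lt_pi h0 h)

theorem mul_pi_sub_lt_pi_mul_sin {t : ℝ} (h0 : 0 < t) (h : t < π) :
    t * (π - t) < π * Real.sin t := by
  wlog hacute : t ≤ π / 2 generalizing t
  · have hsymm := this (t := π - t) (by linarith) (by linarith) (by linarith)
    rw [Real.sin_pi_sub] at hsymm
    linarith
  have hquad : π * t ≤ 6 := by nlinarith [Real.pi_pos, Real.pi_lt_d2]
  calc t * (π - t) ≤ π * (t - t ^ 3 / 6) := by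
        nlinarith [mul_le_mul_of_nonneg_right hquad (sq_nonneg t)]
    _ < π * Real.sin t := mul_lt_mul_of_pos_left (Real.sin_gt_sub_cube h0) Real.pi_pos

theorem sq_mul_pi_sub_lt_pi_mul_sin_sq {y : ℝ} (h0 : 0 < y) (h : y ≤ π / 3) :
    y ^ 2 * (π - y) < π * Real.sin y ^ 2 := by
  have hπ := Real.pi_pos
  have hπ_lt := Real.pi_lt_d4
  have hy : y ≤ 1.05 := by linarith
  have hcubic : π * (y / 3 - y ^ 3 / 36) < 1 := by
    have hmono : y / 3 - y ^ 3 / 36 ≤ 0.318 := by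
      have hprod := mul_nonneg (sub_nonneg.2 hy) h0.le
      nlinarith [mul_nonneg hprod h0.le]
    nlinarith
  have hsin : (y - y ^ 3 / 6) ^ 2 ≤ Real.sin y ^ 2 := by
    have hnonneg : 0 ≤ y - y ^ 3 / 6 := by
      nlinarith [mul_nonneg (sub_nonneg.2 hy) h0.le, mul_nonneg h0.le h0.le]
    exact pow_le_pow_left₀ hnonneg (Real.sin_gt_sub_cube h0).le 2
  calc y ^ 2 * (π - y) < π * (y - y ^ 3 / 6) ^ 2 := by
        nlinarith [mul_lt_mul_of_pos_right hcubic (pow_pos h0 3)]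
    _ ≤ π * Real.sin y ^ 2 := mul_le_mul_of_nonneg_left hsin hπ.le

theorem mul_pi_sub_lt_three_mul_sin_sq {y : ℝ} (h : π / 3 ≤ y) (h' : y ≤ π / 2) :
    y * (π - y) < 3 * Real.sin y ^ 2 := by
  obtain ⟨v, rfl⟩ : ∃ v, y = π / 2 - v := ⟨π / 2 - y, by ring⟩
  have hπ_lt := Real.pi_lt_d2
  have hv0 : 0 ≤ v := by linarith
  have hv_sq : v ^ 2 ≤ 0.525 ^ 2 := pow_le_pow_left₀ hv0 (by linarith) 2
  rw [Real.sin_pi_div_two_sub]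
  have hcos : (1 - v ^ 2 / 2) ^ 2 ≤ Real.cos v ^ 2 :=
    pow_le_pow_left₀ (by linarith) Real.one_sub_sq_div_two_le_cos 2
  have hπ_sq : π ^ 2 < 9.93 := by nlinarith [Real.pi_pos]
  nlinarith

theorem mul_mul_pi_sub_lt_pi_mul_sin_sq {x y : ℝ} (hx : 0 < x) (hxy : x ≤ y) (hx3 : x ≤ π / 3)
    (hy : y ≤ π / 2) : x * y * (π - y) < π * Real.sin y ^ 2 := by
  have hy0 : 0 < y := hx.trans_le hxy
  have hπ_sub : 0 < π - y := by linarith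
  rcases le_total y (π / 3) with hsmall | hlarge
  · calc x * y * (π - y) ≤ y * y * (π - y) := by gcongr
      _ = y ^ 2 * (π - y) := by ring
      _ < π * Real.sin y ^ 2 := sq_mul_pi_sub_lt_pi_mul_sin_sq hy0 hsmall
  · calc x * y * (π - y) ≤ π / 3 * y * (π - y) := by gcongr
      _ = π / 3 * (y * (π - y)) := by ring
      _ < π / 3 * (3 * Real.sin y ^ 2) :=
        mul_lt_mul_of_pos_left (mul_pi_sub_lt_three_mul_sin_sq hlarge hy) (by positivity)
      _ = π * Real.sin y ^ 2 := by ring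

/-! ### Distances from a point on a principal normal to the helix -/

/-- Up to the constant `R ^ 2 + 1`, the squared distance from `(0, -R, 0)` to the point `h(s)` of
the helix. -/
noncomputable def helixPotential (R s : ℝ) : ℝ :=
  s ^ 2 + 2 * R * Real.cos s

theorem helixPotential_abs (R s : ℝ) : helixPotential R |s| = helixPotential R s := by
  rw [helixPotential, helixPotential, sq_abs, Real.cos_abs]

theorem continuous_helixPotential (R : ℝ) : Continuous (helixPotential R) := by
  unfold helixPotential
  fun_prop

theorem hasDerivAt_helixPotential (R s : ℝ) :
    HasDerivAt (helixPotential R) (2 * (s - R * Real.sin s)) s := by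
  have hsum := (hasDerivAt_pow 2 s).add ((Real.hasDerivAt_cos s).const_mul (2 * R))
  refine hsum.congr_deriv ?_
  ring

section TangentSphere

variable {R t : ℝ}

theorem strictAntiOn_helixPotential (ht : t < π) (hR : R * Real.sin t = t) :
    StrictAntiOn (helixPotential R) (Icc 0 t) := by
  refine strictAntiOn_of_deriv_neg (convex_Icc _ _) (continuous_helixPotential R).continuousOn ?_
  rw [interior_Icc]
  rintro s ⟨hs, hst⟩
  have hsin : 0 < Real.sin t := Real.sin_pos_of_pos_of_lt_pi (hs.trans hst) ht
  have hslope : s < R * Real.sin s := by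
    refine lt_of_mul_lt_mul_right ?_ hsin.le
    calc s * Real.sin t < t * Real.sin s := mul_sin_lt_mul_sin hs hst ht.le
      _ = R * Real.sin s * Real.sin t := by rw [mul_right_comm, hR]
  rw [(hasDerivAt_helixPotential R s).deriv]
  linarith

theorem strictMonoOn_helixPotential (ht0 : 0 < t) (hR : R * Real.sin t = t) :
    StrictMonoOn (helixPotential R) (Icc t π) := by
  refine strictMonoOn_of_deriv_pos (convex_Icc _ _) (continuous_helixPotential R).continuousOn ?_
  rw [interior_Icc]
  rintro s ⟨hts, hs⟩
  have hsin : 0 < Real.sin t := Real.sin_pos_of_pos_of_lt_pi ht0 (hts.trans hs)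
  have hslope : R * Real.sin s < s := by
    refine lt_of_mul_lt_mul_right ?_ hsin.le
    calc R * Real.sin s * Real.sin t = t * Real.sin s := by rw [mul_right_comm, hR]
      _ < s * Real.sin t := mul_sin_lt_mul_sin ht0 hts hs.le
  rw [(hasDerivAt_helixPotential R s).deriv]
  linarith

theorem helixPotential_pi_lt_of_pi_lt_abs (hR : 0 ≤ R) {s : ℝ} (hs : π < |s|) :
    helixPotential R π < helixPotential R s := by
  have hsq : π ^ 2 < s ^ 2 := sq_lt_sq.2 (by rwa [abs_of_pos Real.pi_pos])
  rw [helixPotential, helixPotential, Real.cos_pi]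
  nlinarith [Real.neg_one_le_cos s]

theorem helixPotential_lt_of_abs_ne (ht0 : 0 < t) (ht : t < π) (hR : R * Real.sin t = t) {s : ℝ}
    (hs : |s| ≠ t) : helixPotential R t < helixPotential R s := by
  rw [← helixPotential_abs R s]
  have hmono := strictMonoOn_helixPotential ht0 hR
  rcases hs.lt_or_gt with hlt | hgt
  · exact strictAntiOn_helixPotential ht hR ⟨abs_nonneg s, hlt.le⟩ ⟨ht0.le, le_rfl⟩ hlt
  rcases le_or_gt |s| π with hle | hfar
  · exact hmono ⟨le_rfl, ht.le⟩ ⟨hgt.le, hle⟩ hgt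
  · have hsin : 0 < Real.sin t := Real.sin_pos_of_pos_of_lt_pi ht0 ht
    have hR0 : 0 < R := pos_of_mul_pos_left (ht0.trans_eq hR.symm) hsin.le
    calc helixPotential R t < helixPotential R π := hmono ⟨le_rfl, ht.le⟩ ⟨ht.le, le_rfl⟩ ht
      _ < helixPotential R |s| := helixPotential_pi_lt_of_pi_lt_abs hR0.le (by rwa [abs_abs])

end TangentSphere

theorem helixPotential_pi_lt_of_abs_le {m s : ℝ} (hm : 3 ≤ m) (hs : |s| ≤ π - 2 * π / m) :
    helixPotential m π < helixPotential m s := by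
  have hm0 : 0 < m := by linarith
  rw [← helixPotential_abs m s]
  obtain ⟨y, hy⟩ : ∃ y, |s| = π - 2 * y := ⟨(π - |s|) / 2, by ring⟩
  have hxy : π / m ≤ y := by
    rw [hy, mul_div_assoc] at hs
    linarith
  have htrig := mul_mul_pi_sub_lt_pi_mul_sin_sq (div_pos Real.pi_pos hm0) hxy (by gcongr)
    (by linarith [abs_nonneg s])
  have hscaled : y * (π - y) < m * Real.sin y ^ 2 := by
    refine lt_of_mul_lt_mul_left ?_ (div_pos Real.pi_pos hm0).le
    calc π / m * (y * (π - y)) = π / m * y * (π - y) := by ring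
      _ < π * Real.sin y ^ 2 := htrig
      _ = π / m * (m * Real.sin y ^ 2) := by field_simp
  rw [hy, helixPotential, helixPotential, Real.cos_pi_sub, Real.cos_two_mul, Real.cos_pi,
    Real.cos_sq']
  linarith

theorem exists_lt_forall_helixPotential_pi_lt {m : ℝ} (hm : 3 ≤ m) :
    ∃ R, 0 < R ∧ R < m ∧ ∀ s, |s| ≤ π - 2 * π / m ∨ π < |s| →
      helixPotential R π < helixPotential R s := by
  have hcompact : ∀ᶠ R in 𝓝 m, ∀ s ∈ Icc (-(π - 2 * π / m)) (π - 2 * π / m),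
      helixPotential R π < helixPotential R s := by
    refine isCompact_Icc.eventually_forall_of_forall_eventually fun s hs => ?_
    refine ContinuousAt.eventually_lt ?_ ?_ (helixPotential_pi_lt_of_abs_le hm (abs_le.2 hs)) <;>
    · unfold helixPotential
      fun_prop
  have hpos : ∀ᶠ R in 𝓝 m, 0 < R := lt_mem_nhds (by linarith)
  obtain ⟨R, ⟨hR, hR0⟩, hRm⟩ :=
    (((hcompact.and hpos).filter_mono nhdsWithin_le_nhds).and
      (self_mem_nhdsWithin : Iio m ∈ 𝓝[<] m)).exists
  refine ⟨R, hR0, hRm, fun s hs => ?_⟩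
  rcases hs with hnear | hfar
  exacts [hR s (abs_le.1 hnear), helixPotential_pi_lt_of_pi_lt_abs hR0.le hfar]

theorem exists_helixPotential_lt_of_lt {n : ℕ} {d : ℤ} (hd : 1 ≤ d) (hdn : d < n) :
    ∃ R : ℝ, 0 < R ∧ R < n ∧ ∀ e : ℤ, |e| ≠ d →
      helixPotential R (π * d / n) < helixPotential R (π * e / n) := by
  have hd0 : (1 : ℝ) ≤ d := by exact_mod_cast hd
  have hdn' : (d : ℝ) + 1 ≤ n := by exact_mod_cast hdn
  have hn0 : (0 : ℝ) < n := by linarith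
  set t := π * d / n with ht
  have ht0 : 0 < t := by positivity
  have htπ : t < π := by
    rw [ht, div_lt_iff₀ hn0]
    exact mul_lt_mul_of_pos_left (by linarith) Real.pi_pos
  have hsin : 0 < Real.sin t := Real.sin_pos_of_pos_of_lt_pi ht0 htπ
  refine ⟨t / Real.sin t, by positivity, ?_, fun e he => ?_⟩
  · have hgap : π ≤ n * (π - t) := by
      have hnt : n * t = π * d := by
        rw [ht]
        field_simp
      nlinarith [Real.pi_pos]
    rw [div_lt_iff₀ hsin]
    refine lt_of_mul_lt_mul_left ?_ Real.pi_pos.le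
    calc π * t ≤ n * (π - t) * t := by gcongr
      _ = n * (t * (π - t)) := by ring
      _ < n * (π * Real.sin t) :=
        mul_lt_mul_of_pos_left (mul_pi_sub_lt_pi_mul_sin ht0 htπ) hn0
      _ = π * (n * Real.sin t) := by ring
  · refine helixPotential_lt_of_abs_ne ht0 htπ (div_mul_cancel₀ t hsin.ne') fun heq => he ?_
    rw [ht, abs_div, abs_mul, abs_of_pos Real.pi_pos, abs_of_pos hn0, div_left_inj' hn0.ne',
      mul_right_inj' Real.pi_ne_zero] at heq
    exact_mod_cast heq

theorem exists_helixPotential_pi_lt {n : ℕ} (hn : 1 ≤ n) :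
    ∃ R, 0 < R ∧ R < max (n : ℝ) 3 ∧ ∀ e : ℤ, 2 ∣ e - n → |e| ≠ n →
      helixPotential R π < helixPotential R (π * e / n) := by
  obtain ⟨R, hR0, hRm, hR⟩ := exists_lt_forall_helixPotential_pi_lt (le_max_right (n : ℝ) 3)
  refine ⟨R, hR0, hRm, fun e hdvd he => hR _ ?_⟩
  have hn0 : (0 : ℝ) < n := by positivity
  have habs : |π * e / n| = π * |(e : ℝ)| / n := by
    rw [abs_div, abs_mul, abs_of_pos Real.pi_pos, abs_of_pos hn0]
  rw [habs]
  have hgap : |e| ≤ n - 2 ∨ n < |e| := by grind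
  refine hgap.imp (fun hnear => ?_) (fun hfar => ?_)
  · have hnear' : |(e : ℝ)| ≤ n - 2 := by exact_mod_cast hnear
    calc π * |(e : ℝ)| / n ≤ π * (n - 2) / n := by gcongr
      _ = π - 2 * π / n := by field_simp
      _ ≤ π - 2 * π / max (n : ℝ) 3 := by
        gcongr
        exact le_max_left _ _
  · have hfar' : (n : ℝ) < |(e : ℝ)| := by exact_mod_cast hfar
    rw [lt_div_iff₀ hn0]
    exact mul_lt_mul_of_pos_left hfar' Real.pi_pos

theorem exists_helixPotential_lt {n : ℕ} {d : ℤ} (hd : 1 ≤ d) (hdn : d ≤ n) :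
    ∃ R, 0 < R ∧ R < max (n : ℝ) 3 ∧ ∀ e : ℤ, 2 ∣ e - d → |e| ≠ d →
      helixPotential R (π * d / n) < helixPotential R (π * e / n) := by
  rcases hdn.lt_or_eq with hlt | rfl
  · obtain ⟨R, hR0, hRn, hR⟩ := exists_helixPotential_lt_of_lt hd hlt
    exact ⟨R, hR0, hRn.trans_le (le_max_left _ _), fun e _ => hR e⟩
  · have hn0 : (n : ℝ) ≠ 0 := by exact_mod_cast (by lia : n ≠ 0)
    rw [Int.cast_natCast, mul_div_cancel_right₀ π hn0]
    exact exists_helixPotential_pi_lt (by lia)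

/-! ### Delaunay spheres of the sites -/

/-- The point at distance `1 + R` from `h(α)` on the principal normal of the helix at `h(α)`,
beyond the axis. -/
noncomputable def normalPoint (α R : ℝ) : E3 :=
  !₂[α, -R * Real.cos α, -R * Real.sin α]

@[simp] theorem normalPoint_apply_zero (α R : ℝ) : normalPoint α R 0 = α := rfl

@[simp] theorem normalPoint_apply_one (α R : ℝ) : normalPoint α R 1 = -R * Real.cos α := rfl

@[simp] theorem normalPoint_apply_two (α R : ℝ) : normalPoint α R 2 = -R * Real.sin α := rfl

theorem dist_sq_normalPoint_helix (α R s : ℝ) :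
    dist (normalPoint α R) (helix (α + s)) ^ 2 = helixPotential R s + (R ^ 2 + 1) := by
  rw [dist_sq_eq_sum_coord_sq, helixPotential]
  simp only [normalPoint_apply_zero, normalPoint_apply_one, normalPoint_apply_two,
    helix_apply_zero, helix_apply_one, helix_apply_two, Real.cos_add, Real.sin_add]
  linear_combination (R ^ 2 + 2 * R * Real.cos s + Real.cos s ^ 2 + Real.sin s ^ 2) *
    Real.sin_sq_add_cos_sq α + Real.sin_sq_add_cos_sq s

theorem dist_normalPoint_helix_lt_iff (α R s t : ℝ) :
    dist (normalPoint α R) (helix (α + s)) < dist (normalPoint α R) (helix (α + t)) ↔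
      helixPotential R s < helixPotential R t := by
  rw [← sq_lt_sq₀ dist_nonneg dist_nonneg, dist_sq_normalPoint_helix, dist_sq_normalPoint_helix,
    add_lt_add_iff_right]

theorem dist_normalPoint_helix_neg (α R s : ℝ) :
    dist (normalPoint α R) (helix (α + -s)) = dist (normalPoint α R) (helix (α + s)) := by
  rw [← sq_eq_sq₀ dist_nonneg dist_nonneg, dist_sq_normalPoint_helix, dist_sq_normalPoint_helix,
    ← helixPotential_abs, abs_neg, helixPotential_abs]

theorem normalPoint_radial_sq (α R : ℝ) :
    normalPoint α R 1 ^ 2 + normalPoint α R 2 ^ 2 = R ^ 2 := by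
  rw [normalPoint_apply_one, normalPoint_apply_two]
  linear_combination R ^ 2 * Real.sin_sq_add_cos_sq α

theorem helixPoint_eq_helix_midpoint_add (n : ℕ) (i j k : ℤ) :
    helixPoint n k = helix (π * (i + j) / n + π * (2 * k - i - j : ℤ) / n) := by
  rw [helixPoint]
  push_cast
  ring_nf

theorem exists_isDelaunayCenter_of_lt {n : ℕ} {i j : ℤ} (hij : i < j) (hijn : j - i ≤ n) :
    ∃ c, IsDelaunayCenter (range (helixPoint n)) (helixPoint n i) (helixPoint n j) c ∧
      c 1 ^ 2 + c 2 ^ 2 < max (n : ℝ) 3 ^ 2 := by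
  obtain ⟨R, hR0, hRn, hR⟩ := exists_helixPotential_lt (d := j - i) (by lia) hijn
  have hi : helixPoint n i = helix (π * (i + j) / n + -(π * (j - i : ℤ) / n)) := by
    rw [helixPoint_eq_helix_midpoint_add n i j]
    push_cast
    ring_nf
  have hj : helixPoint n j = helix (π * (i + j) / n + π * (j - i : ℤ) / n) := by
    rw [helixPoint_eq_helix_midpoint_add n i j]
    push_cast
    ring_nf
  refine ⟨normalPoint (π * (i + j) / n) R, ⟨?_, ?_⟩, ?_⟩
  · rw [hi, hj, dist_normalPoint_helix_neg]
  · rintro _ ⟨⟨k, rfl⟩, hk⟩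
    have hki : k ≠ i := by
      rintro rfl
      exact hk (mem_insert _ _)
    have hkj : k ≠ j := by
      rintro rfl
      exact hk (mem_insert_of_mem _ rfl)
    rw [hi, dist_normalPoint_helix_neg, helixPoint_eq_helix_midpoint_add n i j k,
      dist_normalPoint_helix_lt_iff]
    exact hR _ (by lia) (by grind)
  · rw [normalPoint_radial_sq]
    exact pow_lt_pow_left₀ hRn hR0.le two_ne_zero

theorem exists_isDelaunayCenter {n : ℕ} {i j : ℤ} (hij : i ≠ j) (hijn : |i - j| ≤ n) :
    ∃ c, IsDelaunayCenter (range (helixPoint n)) (helixPoint n i) (helixPoint n j) c ∧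
      c 1 ^ 2 + c 2 ^ 2 < max (n : ℝ) 3 ^ 2 := by
  rcases hij.lt_or_gt with hlt | hgt
  · exact exists_isDelaunayCenter_of_lt hlt (by grind)
  · obtain ⟨c, hc, hradial⟩ := exists_isDelaunayCenter_of_lt (n := n) hgt (by grind)
    exact ⟨c, hc.symm, hradial⟩

/-! ### Boundedness of the clipped regions -/

theorem isBounded_setOf_coord_mem_Icc (a b : Fin 3 → ℝ) :
    Bornology.IsBounded {x : E3 | ∀ i, x i ∈ Icc (a i) (b i)} := by
  have hbox := (PiLp.antilipschitzWith_ofLp 2 fun _ : Fin 3 => ℝ).isBounded_preimage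
    (Metric.isBounded_Icc a b)
  refine hbox.subset fun x hx => ?_
  exact ⟨fun i => (hx i).1, fun i => (hx i).2⟩

theorem dist_helix_zero_le_dist_helix_iff (x : E3) (s : ℝ) :
    dist x (helix 0) ≤ dist x (helix s) ↔
      x 0 * s + x 2 * Real.sin s ≤ s ^ 2 / 2 + x 1 * (1 - Real.cos s) := by
  rw [← sq_le_sq₀ dist_nonneg dist_nonneg, dist_sq_eq_sum_coord_sq, dist_sq_eq_sum_coord_sq]
  simp only [helix_apply_zero, helix_apply_one, helix_apply_two, Real.cos_zero, Real.sin_zero]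
  constructor <;> intro h <;> linarith [Real.sin_sq_add_cos_sq s]

theorem isBounded_setOf_dist_helix_zero_le {θ : ℝ} (hθ : 0 < θ) (hθπ : θ < π) (R : ℝ) :
    Bornology.IsBounded {x : E3 | x 1 ≤ R ∧ ∀ s ∈ ({θ, -θ, 2 * π, -(2 * π)} : Set ℝ),
      dist x (helix 0) ≤ dist x (helix s)} := by
  have hsin : 0 < Real.sin θ := Real.sin_pos_of_pos_of_lt_pi hθ hθπ
  have hcos : 0 < 1 - Real.cos θ := by
    rw [sub_pos, ← Real.cos_zero]
    exact Real.cos_lt_cos_of_nonneg_of_le_pi le_rfl hθπ.le hθ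
  set M := (θ ^ 2 / 2 + R * (1 - Real.cos θ) + π * θ) / Real.sin θ with hM
  refine (isBounded_setOf_coord_mem_Icc ![-π, -(θ ^ 2 / 2 / (1 - Real.cos θ)), -M]
    ![π, R, M]).subset ?_
  rintro x ⟨hxR, hx⟩
  simp only [forall_mem_insert, mem_singleton_iff, forall_eq, dist_helix_zero_le_dist_helix_iff,
    Real.cos_neg, Real.sin_neg, Real.cos_two_pi, Real.sin_two_pi] at hx
  obtain ⟨hθ_pos, hθ_neg, hpi_pos, hpi_neg⟩ := hx
  have hx0_le : x 0 ≤ π := by nlinarith [Real.pi_pos]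
  have hx0_ge : -π ≤ x 0 := by nlinarith [Real.pi_pos]
  have hx1_mul : x 1 * (1 - Real.cos θ) ≤ R * (1 - Real.cos θ) := by gcongr
  have hx0_mul_le : x 0 * θ ≤ π * θ := by gcongr
  have hx0_mul_ge : -π * θ ≤ x 0 * θ := by gcongr
  have hx1_ge : -(θ ^ 2 / 2 / (1 - Real.cos θ)) ≤ x 1 := by
    rw [← neg_div, div_le_iff₀ hcos]
    linarith
  have hx2 : |x 2| ≤ M := by
    rw [hM, le_div_iff₀ hsin]
    have habs : |x 2 * Real.sin θ| ≤ θ ^ 2 / 2 + R * (1 - Real.cos θ) + π * θ :=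
      abs_le.2 ⟨by linarith, by linarith⟩
    rwa [abs_mul, abs_of_pos hsin] at habs
  intro i
  fin_cases i
  exacts [⟨hx0_ge, hx0_le⟩, ⟨hx1_ge, hxR⟩, abs_le.1 hx2]

theorem isBounded_clippedRegion_zero {n : ℕ} (hn : 3 ≤ n) :
    Bornology.IsBounded (clippedRegion n 0) := by
  have hn0 : (0 : ℝ) < n := by positivity
  have hθπ : 2 * π / n < π := by
    have hn3 : (3 : ℝ) ≤ n := by exact_mod_cast hn
    rw [div_lt_iff₀ hn0]
    nlinarith [Real.pi_pos]
  refine (isBounded_setOf_dist_helix_zero_le (by positivity) hθπ n).subset ?_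
  rintro x ⟨hx, hclip⟩
  have hclose (k : ℤ) : dist x (helix 0) ≤ dist x (helix (2 * π * k / n)) := by
    simpa [helixPoint] using hx (helixPoint n k) (mem_range_self k)
  refine ⟨by simpa [clipHalfspace] using hclip, ?_⟩
  have hfull : 2 * π * n / n = 2 * π := mul_div_cancel_right₀ _ hn0.ne'
  simp only [forall_mem_insert, mem_singleton_iff, forall_eq]
  refine ⟨?_, ?_, ?_, ?_⟩
  · simpa using hclose 1
  · simpa [neg_div] using hclose (-1)
  · simpa [hfull] using hclose n
  · simpa [neg_div, hfull] using hclose (-n)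

theorem isBounded_clippedRegion {n : ℕ} (hn : 3 ≤ n) (t : ℤ) :
    Bornology.IsBounded (clippedRegion n t) := by
  rw [← zero_add t, ← image_screwMotion_clippedRegion]
  exact (screwMotion _).isometry.lipschitz.isBounded_image (isBounded_clippedRegion_zero hn)

theorem helixPoint_radial_sq (n : ℕ) (t : ℤ) :
    helixPoint n t 1 ^ 2 + helixPoint n t 2 ^ 2 = 1 :=
  Real.cos_sq_add_sin_sq _

/-! ### Neighborly families -/

theorem isConvexPolytope3_helixRegion_inter {n : ℕ} (hn : 3 ≤ n) {t : ℤ} {C : Set E3}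
    (hC : IsPolyhedral C) (hnhds : C ∈ 𝓝 (helixPoint n t)) (hclip : C ⊆ clipHalfspace n t) :
    IsConvexPolytope3 (helixRegion n t ∩ C) :=
  isConvexPolytope3_voronoiRegion_inter (isLocallyFiniteSet_range_helixPoint (by lia)) hC hnhds
    ((isBounded_clippedRegion hn t).subset (inter_subset_inter_right _ hclip))

theorem cylinder_mem_nhds_helixPoint {n : ℕ} (hn : 2 ≤ n) (t : ℤ) :
    {x : E3 | x 1 ^ 2 + x 2 ^ 2 < n ^ 2} ∈ 𝓝 (helixPoint n t) := by
  refine cylinder_mem_nhds ?_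
  rw [helixPoint_radial_sq]
  exact one_lt_pow₀ (by exact_mod_cast hn) two_ne_zero

theorem isConvexPolytope3_clippedRegion {n : ℕ} (hn : 3 ≤ n) (t : ℤ) :
    IsConvexPolytope3 (clippedRegion n t) :=
  isConvexPolytope3_helixRegion_inter hn (isPolyhedral_clipHalfspace n t)
    (mem_of_superset (cylinder_mem_nhds_helixPoint (by lia) t) (cylinder_subset_clipHalfspace n t))
    subset_rfl

theorem isConvexPolytope3_helixRegion_inter_clipPrism {n : ℕ} (hn : 3 ≤ n) (t : ℤ) :
    IsConvexPolytope3 (helixRegion n t ∩ clipPrism n) :=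
  isConvexPolytope3_helixRegion_inter hn (isPolyhedral_clipPrism (by lia))
    (mem_of_superset (cylinder_mem_nhds_helixPoint (by lia) t) (cylinder_subset_clipPrism n))
    (iInter_subset _ t)

theorem isFacet_helixRegion_inter {n : ℕ} (hn : 1 ≤ n) {i j : ℤ} (hij : i ≠ j) {c : E3}
    (hc : IsDelaunayCenter (range (helixPoint n)) (helixPoint n i) (helixPoint n j) c) {C : Set E3}
    (hC : C ∈ 𝓝 c) :
    IsFacet (helixRegion n i ∩ C ∩ (helixRegion n j ∩ C)) (helixRegion n i ∩ C) ∧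
      IsFacet (helixRegion n i ∩ C ∩ (helixRegion n j ∩ C)) (helixRegion n j ∩ C) := by
  have hS := isLocallyFiniteSet_range_helixPoint hn
  have hne := (helixPoint_injective hn).ne hij
  refine ⟨hc.isFacet_inter hS (mem_range_self i) (mem_range_self j) hne hC, ?_⟩
  rw [inter_comm]
  exact hc.symm.isFacet_inter hS (mem_range_self j) (mem_range_self i) hne.symm hC

theorem meetInCommonFacets_helixRegion {n : ℕ} (hn : 1 ≤ n) (a : ℤ) :
    MeetInCommonFacets fun i : Fin (n + 1) => helixRegion n (a + (i : ℕ)) := by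
  intro i j hij
  have hne : a + (i : ℕ) ≠ a + (j : ℕ) := by simpa [Fin.ext_iff] using hij
  obtain ⟨c, hc, -⟩ := exists_isDelaunayCenter (n := n) hne (by grind)
  simpa only [inter_univ] using isFacet_helixRegion_inter hn hne hc univ_mem

theorem isNeighborly_clippedRegion {n : ℕ} (hn : 3 ≤ n) (a : ℤ) :
    IsNeighborly fun i : Fin (n + 1) => clippedRegion n (a + (i : ℕ)) := by
  intro i j hij
  have hne : a + (i : ℕ) ≠ a + (j : ℕ) := by simpa [Fin.ext_iff] using hij
  obtain ⟨c, hc, hradial⟩ := exists_isDelaunayCenter (n := n) hne (by grind)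
  rw [max_eq_left (by exact_mod_cast hn)] at hradial
  have hC := mem_of_superset (cylinder_mem_nhds hradial) (subset_inter
    (cylinder_subset_clipHalfspace n (a + (i : ℕ)))
    (cylinder_subset_clipHalfspace n (a + (j : ℕ))))
  have hdim := (isFacet_helixRegion_inter (by lia) hne hc hC).1.2
  rwa [← inter_inter_distrib_right, inter_inter_inter_comm] at hdim

theorem meetInCommonFacets_helixRegion_inter_clipPrism {n : ℕ} (hn : 3 ≤ n) :
    MeetInCommonFacets fun i : Fin (n + 1) => helixRegion n (i : ℕ) ∩ clipPrism n := by
  intro i j hij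
  have hne : ((i : ℕ) : ℤ) ≠ (j : ℕ) := by simpa [Fin.ext_iff] using hij
  obtain ⟨c, hc, hradial⟩ := exists_isDelaunayCenter (n := n) hne (by grind)
  rw [max_eq_left (by exact_mod_cast hn)] at hradial
  exact isFacet_helixRegion_inter (by lia) hne hc
    (mem_of_superset (cylinder_mem_nhds hradial) (cylinder_subset_clipPrism n))

theorem areCongruent_clippedRegion (n : ℕ) (s t : ℤ) :
    AreCongruent (clippedRegion n s) (clippedRegion n t) :=
  ⟨screwMotion ((t - s : ℤ) * stepAngle n), by
    rw [image_screwMotion_clippedRegion, add_sub_cancel]⟩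

theorem areCongruent_helixRegion_inter_clipPrism (n : ℕ) (s t : ℤ) :
    AreCongruent (helixRegion n s ∩ clipPrism n) (helixRegion n t ∩ clipPrism n) :=
  ⟨screwMotion ((t - s : ℤ) * stepAngle n), by
    rw [image_inter (screwMotion _).injective, image_screwMotion_helixRegion,
      image_screwMotion_clipPrism, add_sub_cancel]⟩

theorem MeetInCommonFacets.isNeighborly {ι : Type*} {P : ι → Set E3} (hP : MeetInCommonFacets P) :
    IsNeighborly P :=
  fun _ _ hij => (hP hij).1.2

theorem MeetInCommonFacets.comp_injective {ι κ : Type*} {P : ι → Set E3}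
    (hP : MeetInCommonFacets P) {f : κ → ι} (hf : Function.Injective f) :
    MeetInCommonFacets (P ∘ f) :=
  fun _ _ hij => hP (hf.ne hij)

theorem exists_neighborly_family (m : ℕ) :
    ∃ P : Fin m → Set E3, (∀ i, IsConvexPolytope3 (P i)) ∧ (∀ i j, AreCongruent (P i) (P j)) ∧
      IsNeighborly P ∧ MeetInCommonFacets P := by
  obtain ⟨n, hn, hmn⟩ : ∃ n, 3 ≤ n ∧ m ≤ n + 1 := ⟨m + 3, by lia, by lia⟩
  have hfacets := (meetInCommonFacets_helixRegion_inter_clipPrism hn).comp_injective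
    (Fin.castLE_injective hmn)
  exact ⟨_, fun i => isConvexPolytope3_helixRegion_inter_clipPrism hn i,
    fun i j => areCongruent_helixRegion_inter_clipPrism n i j, hfacets.isNeighborly, hfacets⟩

/-! ### Bitangent spheres -/

theorem hasDerivAt_helix (t : ℝ) : HasDerivAt helix !₂[1, -Real.sin t, Real.cos t] t := by
  refine (PiLp.hasFDerivAt_toLp 2 ![t, Real.cos t, Real.sin t]).comp_hasDerivAt t
    (f := fun s => ![s, Real.cos s, Real.sin s]) (hasDerivAt_pi.2 fun i => ?_)
  fin_cases i
  exacts [hasDerivAt_id t, Real.hasDerivAt_cos t, Real.hasDerivAt_sin t]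

theorem isTangentAt_helix_iff (S : EuclideanGeometry.Sphere E3) (t : ℝ) :
    S.IsTangentAt (helix t) (helixTangentLine t) ↔ dist (helix t) S.center = S.radius ∧
      t - S.center 0 + S.center 1 * Real.sin t - S.center 2 * Real.cos t = 0 := by
  have hmem : helix t ∈ S ↔ dist (helix t) S.center = S.radius := EuclideanGeometry.mem_sphere
  have hle : helixTangentLine t ≤ S.orthRadius (helix t) ↔
      t - S.center 0 + S.center 1 * Real.sin t - S.center 2 * Real.cos t = 0 := by
    rw [helixTangentLine, EuclideanGeometry.Sphere.orthRadius, AffineSubspace.mk'_le_mk'_iff,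
      Submodule.span_singleton_le_iff_mem, Submodule.mem_orthogonal_singleton_iff_inner_right,
      (hasDerivAt_helix t).deriv]
    simp only [PiLp.inner_apply, Fin.sum_univ_three, vsub_eq_sub, PiLp.sub_apply,
      helix_apply_zero, helix_apply_one, helix_apply_two, Matrix.cons_val,
      RCLike.inner_apply, conj_trivial]
    ring_nf
  exact ⟨fun h => ⟨hmem.1 h.mem_sphere, hle.1 h.le_orthRadius⟩,
    fun h => ⟨hmem.2 h.1, AffineSubspace.self_mem_mk' _ _, hle.2 h.2⟩⟩

section Bitangent

variable {t : ℝ}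

theorem IsBitangentSphere.center_eq (h0 : 0 < t) (h : t < π)
    {S : EuclideanGeometry.Sphere E3} (hS : IsBitangentSphere S t) :
    S.center = normalPoint 0 (t / Real.sin t) := by
  have hsin := Real.sin_pos_of_pos_of_lt_pi h0 h
  rw [IsBitangentSphere, isTangentAt_helix_iff, isTangentAt_helix_iff, Real.sin_neg,
    Real.cos_neg] at hS
  obtain ⟨⟨hdist, htangent⟩, hdist_neg, htangent_neg⟩ := hS
  have hdist_sq := congrArg (· ^ 2) (hdist.trans hdist_neg.symm)
  simp only [dist_sq_eq_sum_coord_sq, helix_apply_zero, helix_apply_one, helix_apply_two,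
    Real.sin_neg, Real.cos_neg] at hdist_sq
  have hx : S.center 0 = -(S.center 2 * Real.cos t) := by linarith
  have hequidistant : t * S.center 0 + S.center 2 * Real.sin t = 0 := by linarith
  have hz : S.center 2 = 0 := by
    refine (mul_eq_zero.1 ?_).resolve_right (sub_pos.2 (mul_cos_lt_sin h0 h)).ne'
    linear_combination hequidistant - t * hx
  rw [hz, zero_mul, neg_zero] at hx
  apply eq_of_coord_eq
  · exact hx
  · rw [normalPoint_apply_one, Real.cos_zero, mul_one, ← neg_div, eq_div_iff hsin.ne']
    rw [hx, hz] at htangent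
    linarith
  · rw [hz, normalPoint_apply_two, Real.sin_zero, mul_zero]

theorem isBitangentSphere_iff (h0 : 0 < t) (h : t < π) (S : EuclideanGeometry.Sphere E3) :
    IsBitangentSphere S t ↔
      S = ⟨normalPoint 0 (t / Real.sin t), dist (normalPoint 0 (t / Real.sin t)) (helix t)⟩ := by
  have hsin := Real.sin_pos_of_pos_of_lt_pi h0 h
  constructor
  · intro hS
    have hcenter := hS.center_eq h0 h
    refine EuclideanGeometry.Sphere.ext hcenter ?_
    rw [← hcenter, dist_comm]
    exact (EuclideanGeometry.mem_sphere.1 hS.1.mem_sphere).symm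
  · rintro rfl
    have hneg := dist_normalPoint_helix_neg 0 (t / Real.sin t) t
    rw [zero_add, zero_add] at hneg
    rw [IsBitangentSphere, isTangentAt_helix_iff, isTangentAt_helix_iff]
    simp only [normalPoint_apply_zero, normalPoint_apply_one, normalPoint_apply_two, Real.cos_zero,
      Real.sin_zero, Real.sin_neg, dist_comm (helix _), hneg]
    refine ⟨⟨trivial, ?_⟩, trivial, ?_⟩ <;>
    · field_simp
      ring

theorem existsUnique_isBitangentSphere (h0 : 0 < t) (h : t < π) :
    ∃! S, IsBitangentSphere S t := by
  simp only [isBitangentSphere_iff h0 h]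
  exact existsUnique_eq

theorem IsBitangentSphere.inter_range_helix (h0 : 0 < t) (h : t < π)
    {S : EuclideanGeometry.Sphere E3} (hS : IsBitangentSphere S t) :
    {p | p ∈ S} ∩ range helix = {helix t, helix (-t)} := by
  apply Subset.antisymm
  · rintro _ ⟨hp, s, rfl⟩
    obtain rfl := (isBitangentSphere_iff h0 h S).1 hS
    have hcontact : |s| = t := by
      by_contra hs
      have hR := div_mul_cancel₀ t (Real.sin_pos_of_pos_of_lt_pi h0 h).ne'
      have hlt := (dist_normalPoint_helix_lt_iff 0 _ t s).2 (helixPotential_lt_of_abs_ne h0 h hR hs)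
      rw [zero_add, zero_add] at hlt
      exact hlt.ne (EuclideanGeometry.mem_sphere'.1 hp).symm
    rcases eq_or_eq_neg_of_abs_eq hcontact with rfl | rfl
    exacts [Or.inl rfl, Or.inr rfl]
  · rintro _ (rfl | rfl)
    exacts [⟨hS.1.mem_sphere, t, rfl⟩, ⟨hS.2.mem_sphere, -t, rfl⟩]

end Bitangent

theorem mainTheorem1 :
    -- Arbitrarily large neighborly families of congruent convex 3-polytopes.
    (∀ n : ℕ, 1 ≤ n →
      ∃ P : Fin n → Set E3,
        (∀ i, IsConvexPolytope3 (P i)) ∧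
        (∀ i j, AreCongruent (P i) (P j)) ∧
        IsNeighborly P ∧ MeetInCommonFacets P) ∧
    -- The Voronoi regions of evenly spaced points on the helix: they are permuted by
    -- the screw motion, and any `n + 1` consecutive ones pairwise meet in common facets.
    (∀ n : ℕ, 1 ≤ n →
      Isometry (screw n) ∧
      (∀ t : ℤ, screw n (helixPoint n t) = helixPoint n (t + 1)) ∧
      (∀ t : ℤ, screw n '' helixRegion n t = helixRegion n (t + 1)) ∧
      (∀ t : ℤ, screw n '' clipHalfspace n t = clipHalfspace n (t + 1)) ∧
      (∀ a : ℤ, MeetInCommonFacets fun i : Fin (n + 1) => helixRegion n (a + (i : ℕ)))) ∧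
    -- The clipped regions: any `n + 1` consecutive ones form a neighborly family of
    -- congruent convex 3-polytopes.
    (∀ n : ℕ, 3 ≤ n →
      (∀ t : ℤ, IsConvexPolytope3 (clippedRegion n t)) ∧
      (∀ t : ℤ, screw n '' clippedRegion n t = clippedRegion n (t + 1)) ∧
      (∀ s t : ℤ, AreCongruent (clippedRegion n s) (clippedRegion n t)) ∧
      (∀ a : ℤ, IsNeighborly fun i : Fin (n + 1) => clippedRegion n (a + (i : ℕ)))) ∧
    -- The bitangent lemma.
    (∀ t : ℝ, 0 < t → t < π →
      (∃! S : EuclideanGeometry.Sphere E3, IsBitangentSphere S t) ∧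
      ∀ S : EuclideanGeometry.Sphere E3, IsBitangentSphere S t →
        {p : E3 | p ∈ S} ∩ Set.range helix = {helix t, helix (-t)}) := by
  refine ⟨fun n _ => exists_neighborly_family n, fun n hn => ?_, fun n hn => ?_,
    fun t h0 h => ⟨existsUnique_isBitangentSphere h0 h, fun S hS => hS.inter_range_helix h0 h⟩⟩
  · rw [← coe_screwMotion_stepAngle, ← one_mul (stepAngle n), ← Int.cast_one]
    exact ⟨(screwMotion _).isometry, fun t => screwMotion_helixPoint n t 1,
      fun t => image_screwMotion_helixRegion n t 1, fun t => image_screwMotion_clipHalfspace n t 1,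
      meetInCommonFacets_helixRegion hn⟩
  · rw [← coe_screwMotion_stepAngle, ← one_mul (stepAngle n), ← Int.cast_one]
    exact ⟨isConvexPolytope3_clippedRegion hn, fun t => image_screwMotion_clippedRegion n t 1,
      areCongruent_clippedRegion n, isNeighborly_clippedRegion hn⟩
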